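/- A $k$-round two-prover quantum game $G$ with communication registers of $v_X$ and $v_Y$ qubits consists of unitaries $V_1,\dots,V_{k+1}$ acting on a private register of the verifier (with at least one qubit) and on the two communication registers $\mathrm{com}_X$ ($v_X$ qubits) and $\mathrm{com}_Y$ ($v_Y$ qubits). A $2m$-qubit strategy for $G$ is a triple $(|\psi\rangle,X,Y)$ of a unit vector $|\psi\rangle\in\mathbb{C}^{2^m}\otimes\mathbb{C}^{2^m}$ and sequences $X=(X_1,\dots,X_k)$, $Y=(Y_1,\dots,Y_k)$ of unitaries, where $X_j$ acts on $\mathrm{com}_X$ and on the first half of $|\psi\rangle$, and $Y_j$ acts on $\mathrm{com}_Y$ and on the second half of $|\psi\rangle$. The verifier's private register and the communication registers start in $|0\rangle$; round $j$ applies $V_j$ and then $X_j\otimes Y_j$; after round $k$, $V_{k+1}$ is applied. The value $\omega_G(|\psi\rangle,X,Y)$ is the probability that the verifier's first private qubit is then measured to be $1$. **Theorem.** For each $k$ and each $\varepsilon>0$ there is a family of $k$-round prover circuits $(\mathcal{X}_M,\mathcal{Y}_M)_{M\in\mathbb{N}}$ (defined for all sizes of the communication registers and of the provers' halves of $|\psi\rangle$,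 and acting on these together with one additional $M$-qubit program register for each prover) with the following properties. 1. The circuits are programmable: the unitary of each prover in each round has the form $\sum_{a\in\{0,1\}^M} |a\rangle\langle a|\otimes W_a$, where $|a\rangle$ ranges over the computational basis of the prover's program register and each $W_a$ is a unitary on the rest of that prover's registers. 2. For all $v_X,v_Y,m$ there is an $M_0$ such that for every $M\ge M_0$, every $k$-round two-prover quantum game $G$ with communication registers of $v_X$ and $v_Y$ qubits, and every $2m$-qubit strategy $(|\psi\rangle,X,Y)$ for $G$, there are computational basis states $|A\rangle_M$ and $|B\rangle_M$ of the two program registers such that $$\omega_G(|\psi\rangle|A\rangle_M|B\rangle_M,\mathcal{X}_M,\mathcal{Y}_M)\ \ge\ \omega_G(|\psi\rangle,X,Y)-\varepsilon .$$ -/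

import Mathlib

/-- Labels of the computational basis of an `n`-qubit register, so that `Qubits n → ℂ` is
`(ℂ²)^{⊗ n}`. The label of `|0⟩` is `fun _ => false`. -/
abbrev Qubits (n : ℕ) : Type := Fin n → Bool

/-- Amplitudes of a (normalized) pure state. -/
def IsState {ι : Type} [Fintype ι] (ψ : ι → ℂ) : Prop :=
  ∑ i, ‖ψ i‖ ^ 2 = 1

/-- The computational basis state `|a⟩`. -/
noncomputable def ket {n : ℕ} (a : Qubits n) : Qubits n → ℂ :=
  fun x => if x = a then 1 else 0

/-- The shared state `|ψ⟩|A⟩|B⟩`, where the first prover holds the first half of `ψ` together with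
`A`, and the second prover holds the second half of `ψ` together with `B`. -/
def withAncillas {P Q : Type} {M : ℕ} (ψ : P × Q → ℂ) (A B : Qubits M → ℂ) :
    (P × Qubits M) × (Q × Qubits M) → ℂ :=
  fun i => ψ (i.1.1, i.2.1) * A i.1.2 * B i.2.2

/-- The unitaries that a prover with private register `P` can apply: they act on her `c`-qubit
communication register and on her private register. -/
abbrev ProverUnitary (c : ℕ) (P : Type) [Fintype P] [DecidableEq P] : Type :=
  Matrix.unitaryGroup (Qubits c × P) ℂ

/-- A prover unitary whose private register is `P` together with an `M`-qubit program register is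
programmable if it is of the form `∑ₐ |a⟩⟨a| ⊗ W a`: the program qubits are only used as controls in
the computational basis, to select the unitary `W a` applied to the working register. -/
def IsProgrammable {c M : ℕ} {P : Type} [Fintype P] [DecidableEq P]
    (U : ProverUnitary c (P × Qubits M)) : Prop :=
  ∃ W : Qubits M → ProverUnitary c P, ∀ (x x' : Qubits c) (p p' : P) (a a' : Qubits M),
    U.1 (x, (p, a)) (x', (p', a')) = if a = a' then (W a).1 (x, p) (x', p') else 0

/-- A `k`-round two-prover quantum game with communication registers of `vX` and `vY` qubits.
The verifier has a private register of `r + 1` qubits, and `k + 1` unitary circuits acting on the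
private register and on the two communication registers. -/
structure QuantumGame (k vX vY : ℕ) where
  r : ℕ
  V : Fin (k + 1) → Matrix.unitaryGroup (Qubits (r + 1) × Qubits vX × Qubits vY) ℂ

/-- Basis labels of the whole system: private register of the verifier, the two communication
registers, and the private registers of the two provers. -/
abbrev Global (r vX vY : ℕ) (P Q : Type) : Type :=
  Qubits (r + 1) × Qubits vX × Qubits vY × P × Q

section Run

variable {r vX vY : ℕ} {P Q : Type}

/-- The initial state `|0⟩|0⟩|0⟩|ψ⟩`. -/
def initialState (ψ : P × Q → ℂ) : Global r vX vY P Q → ℂ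
  | (z, x, y, p, q) =>
    if z = (fun _ => false) ∧ x = (fun _ => false) ∧ y = (fun _ => false) then ψ (p, q) else 0

/-- Application of a verifier circuit (tensored with the identity on the provers' registers). -/
def verifierStep (U : Matrix.unitaryGroup (Qubits (r + 1) × Qubits vX × Qubits vY) ℂ)
    (φ : Global r vX vY P Q → ℂ) : Global r vX vY P Q → ℂ
  | (z, x, y, p, q) => ∑ z', ∑ x', ∑ y', U.1 (z, x, y) (z', x', y') * φ (z', x', y', p, q)

variable [Fintype P] [DecidableEq P] [Fintype Q] [DecidableEq Q]

/-- Simultaneous application of the provers' circuits, that is of `I ⊗ X ⊗ Y`. -/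
def proverStep (X : ProverUnitary vX P) (Y : ProverUnitary vY Q)
    (φ : Global r vX vY P Q → ℂ) : Global r vX vY P Q → ℂ
  | (z, x, y, p, q) => ∑ x', ∑ y', ∑ p', ∑ q',
      X.1 (x, p) (x', p') * Y.1 (y, q) (y', q') * φ (z, x', y', p', q')

/-- The state after `n` rounds; each round applies the verifier's circuit and then the provers'
circuits of that round. -/
def runRounds (ψ : P × Q → ℂ) : (n : ℕ) →
    (Fin n → Matrix.unitaryGroup (Qubits (r + 1) × Qubits vX × Qubits vY) ℂ) →
    (Fin n → ProverUnitary vX P) → (Fin n → ProverUnitary vY Q) → Global r vX vY P Q → ℂ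
  | 0, _, _, _ => initialState ψ
  | n + 1, V, X, Y =>
    proverStep (X (Fin.last n)) (Y (Fin.last n)) (verifierStep (V (Fin.last n))
      (runRounds ψ n (fun j => V j.castSucc) (fun j => X j.castSucc) (fun j => Y j.castSucc)))

end Run

/-- The value of the strategy `(ψ, X, Y)`: the probability that, after the `k` rounds and the last
verifier circuit, the first private qubit of the verifier is measured to be `1`. -/
noncomputable def QuantumGame.value {k vX vY : ℕ} (G : QuantumGame k vX vY) {P Q : Type}
    [Fintype P] [DecidableEq P] [Fintype Q] [DecidableEq Q] (ψ : P × Q → ℂ)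
    (X : Fin k → ProverUnitary vX P) (Y : Fin k → ProverUnitary vY Q) : ℝ :=
  ∑ g : Global G.r vX vY P Q, if g.1 0 = true then
    ‖verifierStep (G.V (Fin.last k)) (runRounds ψ k (fun j => G.V j.castSucc) X Y) g‖ ^ 2 else 0

/-!
By compactness, a dense sequence of `k`-tuples of unitaries contains, for every `δ > 0`, a finite
initial segment that is a `δ`-net in operator norm. The program register holds the index of an
element of this sequence, and the programmable circuit applies its `j`-th component in round `j`.
A run of the game is a product of unitaries, in which every prover unitary occurs once, so replacing
the `2k` prover unitaries by `δ`-close ones moves the final state by at most `2kδ`, and the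
acceptance probability by at most twice that.
-/

open WithLp Matrix

section CompactNet

instance compactSpace_unitaryGroup {n 𝕜 : Type*} [Fintype n] [DecidableEq n] [RCLike 𝕜] :
    CompactSpace (unitaryGroup n 𝕜) := by
  have hball : IsCompact {A : Matrix n n 𝕜 | ∀ i ∈ Set.univ, A i ∈
      {v : n → 𝕜 | ∀ j ∈ Set.univ, v j ∈ Metric.closedBall 0 1}} :=
    isCompact_univ_pi fun _ => isCompact_univ_pi fun _ => isCompact_closedBall 0 1
  refine isCompact_iff_compactSpace.mp
    (hball.of_isClosed_subset (isClosed_unitary (R := Matrix n n 𝕜)) fun U hU i _ j _ => ?_)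
  simpa using entry_norm_bound_of_unitary hU i j

lemma exists_forall_exists_lt_dist_denseSeq_lt (α : Type*) [PseudoMetricSpace α] [CompactSpace α]
    [Nonempty α] {δ : ℝ} (hδ : 0 < δ) :
    ∃ N : ℕ, ∀ x : α, ∃ n < N, dist x (TopologicalSpace.denseSeq α n) < δ := by
  obtain ⟨t, ht⟩ := isCompact_univ.elim_finite_subcover
    (fun n => Metric.ball (TopologicalSpace.denseSeq α n) δ) (fun _ => Metric.isOpen_ball)
    fun x _ => Set.mem_iUnion.mpr ((TopologicalSpace.denseRange_denseSeq α).exists_dist_lt x hδ)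
  refine ⟨t.sup id + 1, fun x => ?_⟩
  obtain ⟨n, hnt, hn⟩ := Set.mem_iUnion₂.mp (ht (Set.mem_univ x))
  exact ⟨n, Nat.lt_succ_of_le (Finset.le_sup (f := id) hnt), hn⟩

end CompactNet

section BlockUnitary

variable {ι A B R : Type*} [Fintype ι] [DecidableEq ι] [Fintype A] [DecidableEq A] [Fintype B]
  [DecidableEq B]

section Algebra

variable [CommRing R] [StarRing R]

/-- The block diagonal matrices `∑ b, D b ⊗ |b⟩⟨b|` on a system `ι` decomposed by `e` into a working
register `A` and a control register `B`. A constant family `D` gives the action of a matrix on the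
tensor factor `A`, and a varying one gives the action of a controlled gate. -/
def blockStarAlgHom (e : ι ≃ A × B) : (B → Matrix A A R) →⋆ₐ[R] Matrix ι ι R where
  toFun D := (blockDiagonal D).submatrix e e
  map_one' := by simp
  map_mul' D E := by
    rw [submatrix_mul_equiv]
    exact congrArg (submatrix · e e) (blockDiagonal_mul D E)
  map_zero' := by simp
  map_add' D E := congrArg (submatrix · e e) (blockDiagonal_add D E)
  commutes' r := by
    have hscalar : algebraMap R (B → Matrix A A R) r = fun _ => diagonal fun _ => r := rfl
    rw [hscalar, blockDiagonal_diagonal, submatrix_diagonal_equiv]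
    rfl
  map_star' D := congrArg (submatrix · e e) (blockDiagonal_conjTranspose D).symm

lemma blockStarAlgHom_apply (e : ι ≃ A × B) (D : B → Matrix A A R) (i j : ι) :
    blockStarAlgHom e D i j = if (e i).2 = (e j).2 then D (e i).2 (e i).1 (e j).1 else 0 :=
  blockDiagonal_apply D (e i) (e j)

/-- The unitary `∑ b, W b ⊗ |b⟩⟨b|`, which applies to the register `A` the unitary selected by the
control register `B`. -/
def blockUnitary (e : ι ≃ A × B) (W : B → unitaryGroup A R) : unitaryGroup ι R :=
  ⟨blockStarAlgHom e fun b => (W b).1,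
    Unitary.map_mem (blockStarAlgHom e)
      ⟨funext fun b => (W b).2.1, funext fun b => (W b).2.2⟩⟩

lemma blockUnitary_mulVec_apply (e : ι ≃ A × B) (W : B → unitaryGroup A R) (φ : ι → R) (i : ι) :
    ((blockUnitary e W).1 *ᵥ φ) i = ∑ a, (W (e i).2).1 (e i).1 a * φ (e.symm (a, (e i).2)) := by
  simp only [blockUnitary, mulVec, dotProduct, blockStarAlgHom_apply]
  rw [← e.symm.sum_comp]
  simp [Fintype.sum_prod_type, ite_mul]

end Algebra

open scoped Matrix.Norms.L2Operator

lemma dist_blockUnitary_le (e : ι ≃ A × B) (W W' : B → unitaryGroup A ℂ) :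
    dist (blockUnitary e W) (blockUnitary e W') ≤ dist W W' := by
  have hnorm := NonUnitalStarAlgHom.norm_apply_le (blockStarAlgHom e)
    ((fun b => (W b).1) - fun b => (W' b).1)
  rwa [map_sub, ← dist_eq_norm, ← dist_eq_norm] at hnorm

end BlockUnitary

lemma dist_unitary_mul_mul_le {E : Type*} [NormedRing E] [StarRing E] [CStarRing E]
    (U U' V V' : unitary E) : dist (U * V) (U' * V') ≤ dist U U' + dist V V' := by
  have hleft : dist (U * V) (U' * V) = dist U U' := by
    simp only [Subtype.dist_eq, dist_eq_norm, Submonoid.coe_mul, ← sub_mul,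
      CStarRing.norm_mul_coe_unitary]
  have hright : dist (U' * V) (U' * V') = dist V V' := by
    simp only [Subtype.dist_eq, dist_eq_norm, Submonoid.coe_mul, ← mul_sub,
      CStarRing.norm_coe_unitary_mul]
  exact (dist_triangle _ (U' * V) _).trans_eq (by rw [hleft, hright])

section Measurement

variable {ι : Type} [Fintype ι]

lemma isState_iff_norm_toLp_eq_one {φ : ι → ℂ} : IsState φ ↔ ‖toLp 2 φ‖ = 1 := by
  rw [IsState, ← pow_eq_one_iff_of_nonneg (norm_nonneg _) two_ne_zero, EuclideanSpace.norm_sq_eq]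

lemma IsState.unitary_mulVec [DecidableEq ι] {φ : ι → ℂ} (hφ : IsState φ) (U : unitaryGroup ι ℂ) :
    IsState (U.1 *ᵥ φ) := by
  rw [isState_iff_norm_toLp_eq_one] at hφ ⊢
  rw [← hφ, ← toEuclideanCLM_toLp]
  exact ContinuousLinearMap.norm_map_of_mem_unitary (Unitary.map_mem toEuclideanCLM U.2) _

/-- The probability that a computational basis measurement of the state `φ` gives an outcome
satisfying `p`. -/
noncomputable def outcomeProb (p : ι → Prop) [DecidablePred p] (φ : ι → ℂ) : ℝ :=
  ∑ i, if p i then ‖φ i‖ ^ 2 else 0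

variable (p : ι → Prop) [DecidablePred p]

lemma outcomeProb_eq_norm_sq (φ : ι → ℂ) :
    outcomeProb p φ = ‖toLp 2 fun i => if p i then φ i else 0‖ ^ 2 := by
  simp only [outcomeProb, EuclideanSpace.norm_sq_eq, apply_ite norm, ite_pow, norm_zero, ne_eq,
    OfNat.ofNat_ne_zero, not_false_eq_true, zero_pow]

lemma norm_toLp_ite_le (φ : ι → ℂ) : ‖toLp 2 fun i => if p i then φ i else 0‖ ≤ ‖toLp 2 φ‖ := by
  refine le_of_sq_le_sq ?_ (norm_nonneg _)
  rw [← outcomeProb_eq_norm_sq, EuclideanSpace.norm_sq_eq]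
  exact Finset.sum_le_sum fun i _ => by split_ifs <;> simp

lemma abs_outcomeProb_sub_le (φ χ : ι → ℂ) :
    |outcomeProb p φ - outcomeProb p χ| ≤
      (‖toLp 2 φ‖ + ‖toLp 2 χ‖) * ‖toLp 2 (φ - χ)‖ := by
  set u := toLp 2 fun i => if p i then φ i else 0
  set v := toLp 2 fun i => if p i then χ i else 0
  have hsub : u - v = toLp 2 fun i => if p i then (φ - χ) i else 0 := by
    ext i
    by_cases h : p i <;> simp [u, v, h]
  calc |outcomeProb p φ - outcomeProb p χ|
      = (‖u‖ + ‖v‖) * |‖u‖ - ‖v‖| := by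
        rw [outcomeProb_eq_norm_sq, outcomeProb_eq_norm_sq, sq_sub_sq, abs_mul,
          abs_of_nonneg (by positivity)]
    _ ≤ (‖u‖ + ‖v‖) * ‖u - v‖ := by gcongr; exact abs_norm_sub_norm_le u v
    _ ≤ (‖toLp 2 φ‖ + ‖toLp 2 χ‖) * ‖toLp 2 (φ - χ)‖ := by
        rw [hsub]
        gcongr <;> exact norm_toLp_ite_le p _

open scoped Matrix.Norms.L2Operator in
lemma IsState.abs_outcomeProb_unitary_mulVec_sub_le [DecidableEq ι] {φ : ι → ℂ} (hφ : IsState φ)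
    (U V : unitaryGroup ι ℂ) :
    |outcomeProb p (U.1 *ᵥ φ) - outcomeProb p (V.1 *ᵥ φ)| ≤ 2 * dist U V := by
  have hnorm {W : unitaryGroup ι ℂ} : ‖toLp 2 (W.1 *ᵥ φ)‖ = 1 :=
    isState_iff_norm_toLp_eq_one.mp (hφ.unitary_mulVec W)
  have hdist : ‖toLp 2 (U.1 *ᵥ φ - V.1 *ᵥ φ)‖ ≤ dist U V := by
    rw [← sub_mulVec, Subtype.dist_eq, dist_eq_norm]
    simpa [isState_iff_norm_toLp_eq_one.mp hφ] using l2_opNorm_mulVec (U.1 - V.1) (toLp 2 φ)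
  calc |outcomeProb p (U.1 *ᵥ φ) - outcomeProb p (V.1 *ᵥ φ)|
      ≤ (1 + 1) * ‖toLp 2 (U.1 *ᵥ φ - V.1 *ᵥ φ)‖ := by
        simpa only [hnorm] using abs_outcomeProb_sub_le p (U.1 *ᵥ φ) (V.1 *ᵥ φ)
    _ ≤ 2 * dist U V := by rw [one_add_one_eq_two]; gcongr

end Measurement

section Run

variable {r vX vY : ℕ} {P Q : Type}

/-- The verifier's registers as a tensor factor of the whole system. -/
def verifierEquiv : Global r vX vY P Q ≃ (Qubits (r + 1) × Qubits vX × Qubits vY) × (P × Q) where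
  toFun g := ((g.1, g.2.1, g.2.2.1), g.2.2.2)
  invFun g := (g.1.1, g.1.2.1, g.1.2.2, g.2)

/-- The first prover's registers as a tensor factor of the whole system. -/
def firstProverEquiv : Global r vX vY P Q ≃ (Qubits vX × P) × (Qubits (r + 1) × Qubits vY × Q) where
  toFun g := ((g.2.1, g.2.2.2.1), (g.1, g.2.2.1, g.2.2.2.2))
  invFun g := (g.2.1, g.1.1, g.2.2.1, g.1.2, g.2.2.2)

/-- The second prover's registers as a tensor factor of the whole system. -/
def secondProverEquiv :
    Global r vX vY P Q ≃ (Qubits vY × Q) × (Qubits (r + 1) × Qubits vX × P) where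
  toFun g := ((g.2.2.1, g.2.2.2.2), (g.1, g.2.1, g.2.2.2.1))
  invFun g := (g.2.1, g.2.2.1, g.1.1, g.2.2.2, g.1.2)

variable [Fintype P] [Fintype Q]

lemma isState_initialState {ψ : P × Q → ℂ} (hψ : IsState ψ) :
    IsState (initialState ψ : Global r vX vY P Q → ℂ) := by
  rw [IsState, ← hψ]
  refine (Fintype.sum_of_injective
    (fun i : P × Q => (fun _ => false, fun _ => false, fun _ => false, i))
    (fun i j h => by simpa using h) _ _ ?_ fun i => by simp [initialState]).symm
  rintro ⟨z, x, y, p, q⟩ hg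
  have hzero : ¬(z = (fun _ => false) ∧ x = (fun _ => false) ∧ y = fun _ => false) := by
    rintro ⟨rfl, rfl, rfl⟩
    exact hg ⟨(p, q), rfl⟩
  simp [initialState, hzero]

variable [DecidableEq P] [DecidableEq Q]

/-- The verifier's unitary as a unitary of the whole system. -/
def verifierUnitary (U : unitaryGroup (Qubits (r + 1) × Qubits vX × Qubits vY) ℂ) :
    unitaryGroup (Global r vX vY P Q) ℂ :=
  blockUnitary verifierEquiv fun _ => U

/-- The unitary `I ⊗ X ⊗ Y` of the whole system. -/
def proverUnitary (X : ProverUnitary vX P) (Y : ProverUnitary vY Q) :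
    unitaryGroup (Global r vX vY P Q) ℂ :=
  blockUnitary firstProverEquiv (fun _ => X) * blockUnitary secondProverEquiv fun _ => Y

/-- The unitary of the whole system that carries out the first `n` rounds. -/
def runUnitary : (n : ℕ) → (Fin n → unitaryGroup (Qubits (r + 1) × Qubits vX × Qubits vY) ℂ) →
    (Fin n → ProverUnitary vX P) → (Fin n → ProverUnitary vY Q) →
    unitaryGroup (Global r vX vY P Q) ℂ
  | 0, _, _, _ => 1
  | n + 1, V, X, Y =>
    proverUnitary (X (Fin.last n)) (Y (Fin.last n)) * (verifierUnitary (V (Fin.last n)) *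
      runUnitary n (fun j => V j.castSucc) (fun j => X j.castSucc) (fun j => Y j.castSucc))

lemma verifierUnitary_mulVec (U : unitaryGroup (Qubits (r + 1) × Qubits vX × Qubits vY) ℂ)
    (φ : Global r vX vY P Q → ℂ) : (verifierUnitary U).1 *ᵥ φ = verifierStep U φ := by
  ext ⟨z, x, y, p, q⟩
  simp [verifierUnitary, blockUnitary_mulVec_apply, verifierStep, verifierEquiv,
    Fintype.sum_prod_type]

lemma proverUnitary_mulVec (X : ProverUnitary vX P) (Y : ProverUnitary vY Q)
    (φ : Global r vX vY P Q → ℂ) : (proverUnitary X Y).1 *ᵥ φ = proverStep X Y φ := by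
  ext ⟨z, x, y, p, q⟩
  simp only [proverUnitary, Submonoid.coe_mul, ← mulVec_mulVec, blockUnitary_mulVec_apply,
    proverStep, firstProverEquiv, secondProverEquiv, Fintype.sum_prod_type,
    Equiv.coe_fn_mk, Equiv.coe_fn_symm_mk, Finset.mul_sum, mul_assoc]
  exact Finset.sum_congr rfl fun x' _ => Finset.sum_comm

lemma runUnitary_mulVec (ψ : P × Q → ℂ) (n : ℕ)
    (V : Fin n → unitaryGroup (Qubits (r + 1) × Qubits vX × Qubits vY) ℂ)
    (X : Fin n → ProverUnitary vX P) (Y : Fin n → ProverUnitary vY Q) :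
    (runUnitary n V X Y).1 *ᵥ initialState ψ = runRounds ψ n V X Y := by
  induction n with
  | zero => simp [runUnitary, runRounds]
  | succ n ih =>
    simp only [runUnitary, runRounds, Submonoid.coe_mul, ← mulVec_mulVec, ih,
      verifierUnitary_mulVec, proverUnitary_mulVec]

open scoped Matrix.Norms.L2Operator

lemma dist_proverUnitary_le (X X' : ProverUnitary vX P) (Y Y' : ProverUnitary vY Q) :
    dist (proverUnitary X Y : unitaryGroup (Global r vX vY P Q) ℂ) (proverUnitary X' Y') ≤
      dist X X' + dist Y Y' :=
  (dist_unitary_mul_mul_le _ _ _ _).trans <| add_le_add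
    ((dist_blockUnitary_le _ _ _).trans (dist_pi_const_le X X'))
    ((dist_blockUnitary_le _ _ _).trans (dist_pi_const_le Y Y'))

lemma dist_runUnitary_le (n : ℕ)
    (V : Fin n → unitaryGroup (Qubits (r + 1) × Qubits vX × Qubits vY) ℂ)
    (X X' : Fin n → ProverUnitary vX P) (Y Y' : Fin n → ProverUnitary vY Q) :
    dist (runUnitary n V X Y) (runUnitary n V X' Y') ≤
      ∑ j, (dist (X j) (X' j) + dist (Y j) (Y' j)) := by
  induction n with
  | zero => simp [runUnitary]
  | succ n ih =>
    rw [Fin.sum_univ_castSucc, add_comm (Finset.sum _ _)]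
    refine (dist_unitary_mul_mul_le _ _ _ _).trans
      (add_le_add (dist_proverUnitary_le _ _ _ _) ?_)
    refine (dist_unitary_mul_mul_le _ _ _ _).trans ?_
    rw [dist_self, zero_add]
    exact ih _ _ _ _ _

lemma QuantumGame.value_eq_outcomeProb {k : ℕ} (G : QuantumGame k vX vY) (ψ : P × Q → ℂ)
    (X : Fin k → ProverUnitary vX P) (Y : Fin k → ProverUnitary vY Q) :
    G.value ψ X Y = outcomeProb (fun g : Global G.r vX vY P Q => g.1 0 = true)
      ((verifierUnitary (G.V (Fin.last k)) *
        runUnitary k (fun j => G.V j.castSucc) X Y).1 *ᵥ initialState ψ) := by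
  rw [Submonoid.coe_mul, ← mulVec_mulVec, runUnitary_mulVec, verifierUnitary_mulVec]
  rfl

lemma QuantumGame.abs_value_sub_le {k : ℕ} (G : QuantumGame k vX vY) {ψ : P × Q → ℂ}
    (hψ : IsState ψ) (X X' : Fin k → ProverUnitary vX P) (Y Y' : Fin k → ProverUnitary vY Q) :
    |G.value ψ X Y - G.value ψ X' Y'| ≤ 2 * ∑ j, (dist (X j) (X' j) + dist (Y j) (Y' j)) := by
  rw [value_eq_outcomeProb, value_eq_outcomeProb]
  refine ((isState_initialState hψ).abs_outcomeProb_unitary_mulVec_sub_le _ _ _).trans ?_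
  gcongr
  refine (dist_unitary_mul_mul_le _ _ _ _).trans ?_
  rw [dist_self, zero_add]
  exact dist_runUnitary_le k _ X X' Y Y'

lemma QuantumGame.abs_value_sub_le_of_dist_le {k : ℕ} (G : QuantumGame k vX vY) {ψ : P × Q → ℂ}
    (hψ : IsState ψ) {X X' : Fin k → ProverUnitary vX P} {Y Y' : Fin k → ProverUnitary vY Q}
    {δ : ℝ} (hX : dist X X' ≤ δ) (hY : dist Y Y' ≤ δ) :
    |G.value ψ X Y - G.value ψ X' Y'| ≤ 4 * k * δ :=
  calc |G.value ψ X Y - G.value ψ X' Y'|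
      ≤ 2 * ∑ j, (dist (X j) (X' j) + dist (Y j) (Y' j)) := G.abs_value_sub_le hψ X X' Y Y'
    _ ≤ 2 * ∑ _j : Fin k, (δ + δ) := by
        gcongr with j
        · exact (dist_le_pi_dist X X' j).trans hX
        · exact (dist_le_pi_dist Y Y' j).trans hY
    _ = 4 * k * δ := by
        rw [Finset.sum_const, Finset.card_univ, Fintype.card_fin, nsmul_eq_mul]
        ring

end Run

section Programs

variable {c r vX vY M : ℕ} {P Q : Type}

/-- The state `φ|a⟩|b⟩` of the whole system, where the first prover holds the program `a` and the
second prover holds the program `b`. -/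
noncomputable def withPrograms (a b : Qubits M) (φ : Global r vX vY P Q → ℂ) :
    Global r vX vY (P × Qubits M) (Q × Qubits M) → ℂ
  | (z, x, y, p, q) => φ (z, x, y, p.1, q.1) * ket a p.2 * ket b q.2

lemma initialState_withAncillas (ψ : P × Q → ℂ) (a b : Qubits M) :
    (initialState (withAncillas ψ (ket a) (ket b)) : Global r vX vY _ _ → ℂ) =
      withPrograms a b (initialState ψ) := by
  ext ⟨z, x, y, p, q⟩
  simp only [initialState, withAncillas, withPrograms, ite_mul, zero_mul]

lemma verifierStep_withPrograms (U : unitaryGroup (Qubits (r + 1) × Qubits vX × Qubits vY) ℂ)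
    (a b : Qubits M) (φ : Global r vX vY P Q → ℂ) :
    verifierStep U (withPrograms a b φ) = withPrograms a b (verifierStep U φ) := by
  ext ⟨z, x, y, p, q⟩
  simp only [verifierStep, withPrograms, Finset.sum_mul, mul_assoc]

variable [Fintype P] [Fintype Q]

lemma outcomeProb_withPrograms (a b : Qubits M) (φ : Global r vX vY P Q → ℂ) :
    outcomeProb (fun g => g.1 0 = true) (withPrograms a b φ) =
      outcomeProb (fun g => g.1 0 = true) φ := by
  refine (Fintype.sum_of_injective
    (fun (z, x, y, p, q) => (z, x, y, (p, a), (q, b))) ?_ _ _ ?_ ?_).symm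
  · rintro ⟨z, x, y, p, q⟩ ⟨z', x', y', p', q'⟩ h
    simpa using h
  · rintro ⟨z, x, y, ⟨p, a'⟩, ⟨q, b'⟩⟩ hg
    have hab : ¬(a' = a ∧ b' = b) := by
      rintro ⟨rfl, rfl⟩
      exact hg ⟨(z, x, y, p, q), rfl⟩
    by_cases ha : a' = a <;> simp_all [withPrograms, ket]
  · rintro ⟨z, x, y, p, q⟩
    simp [withPrograms, ket]

variable [DecidableEq P] [DecidableEq Q]

/-- The programmable unitary `∑ a, |a⟩⟨a| ⊗ W a`. -/
def programUnitary (W : Qubits M → ProverUnitary c P) : ProverUnitary c (P × Qubits M) :=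
  blockUnitary (Equiv.prodAssoc _ _ _).symm W

lemma programUnitary_apply (W : Qubits M → ProverUnitary c P) (x x' : Qubits c) (p p' : P)
    (a a' : Qubits M) :
    (programUnitary W).1 (x, (p, a)) (x', (p', a')) =
      if a = a' then (W a).1 (x, p) (x', p') else 0 :=
  blockStarAlgHom_apply _ _ _ _

lemma isProgrammable_programUnitary (W : Qubits M → ProverUnitary c P) :
    IsProgrammable (programUnitary W) :=
  ⟨W, programUnitary_apply W⟩

lemma proverStep_withPrograms (W : Qubits M → ProverUnitary vX P)
    (Z : Qubits M → ProverUnitary vY Q) (a b : Qubits M) (φ : Global r vX vY P Q → ℂ) :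
    proverStep (programUnitary W) (programUnitary Z) (withPrograms a b φ) =
      withPrograms a b (proverStep (W a) (Z b) φ) := by
  ext ⟨z, x, y, ⟨p, a'⟩, ⟨q, b'⟩⟩
  simp only [proverStep, withPrograms, Fintype.sum_prod_type, programUnitary_apply, ket,
    mul_ite, ite_mul, mul_one, mul_zero, zero_mul, Finset.sum_ite_eq', Finset.mem_univ, if_true]
  by_cases ha : a' = a <;> by_cases hb : b' = b <;> simp [ha, hb]

lemma runRounds_withAncillas (ψ : P × Q → ℂ) (a b : Qubits M) (n : ℕ)
    (V : Fin n → unitaryGroup (Qubits (r + 1) × Qubits vX × Qubits vY) ℂ)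
    (W : Fin n → Qubits M → ProverUnitary vX P) (Z : Fin n → Qubits M → ProverUnitary vY Q) :
    runRounds (withAncillas ψ (ket a) (ket b)) n V (fun j => programUnitary (W j))
        (fun j => programUnitary (Z j)) =
      withPrograms a b (runRounds ψ n V (fun j => W j a) (fun j => Z j b)) := by
  induction n with
  | zero => exact initialState_withAncillas ψ a b
  | succ n ih => rw [runRounds, ih, verifierStep_withPrograms, proverStep_withPrograms, runRounds]

lemma QuantumGame.value_withAncillas {k : ℕ} (G : QuantumGame k vX vY) (ψ : P × Q → ℂ)
    (a b : Qubits M) (W : Fin k → Qubits M → ProverUnitary vX P)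
    (Z : Fin k → Qubits M → ProverUnitary vY Q) :
    G.value (withAncillas ψ (ket a) (ket b)) (fun j => programUnitary (W j))
        (fun j => programUnitary (Z j)) =
      G.value ψ (fun j => W j a) (fun j => Z j b) := by
  rw [value, runRounds_withAncillas, verifierStep_withPrograms]
  exact outcomeProb_withPrograms a b _

end Programs

section UniversalCircuit

open scoped Matrix.Norms.L2Operator

/-- The `k`-tuple of unitaries encoded by the program `a`: the element of a dense sequence whose
index is the position of `a` in an enumeration of the basis labels. -/
noncomputable def decodeProgram (k c : ℕ) (P : Type) [Fintype P] [DecidableEq P] {M : ℕ}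
    (a : Qubits M) : Fin k → ProverUnitary c P :=
  TopologicalSpace.denseSeq (Fin k → ProverUnitary c P) (Fintype.equivFin (Qubits M) a)

lemma exists_forall_exists_dist_decodeProgram_lt (k c : ℕ) (P : Type) [Fintype P] [DecidableEq P]
    {δ : ℝ} (hδ : 0 < δ) :
    ∃ M₀ : ℕ, ∀ M, M₀ ≤ M → ∀ X : Fin k → ProverUnitary c P,
      ∃ a : Qubits M, dist X (decodeProgram k c P a) < δ := by
  obtain ⟨N, hN⟩ := exists_forall_exists_lt_dist_denseSeq_lt (Fin k → ProverUnitary c P) hδ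
  refine ⟨N, fun M hM X => ?_⟩
  obtain ⟨n, hnN, hn⟩ := hN X
  have hcard : n < Fintype.card (Qubits M) := by
    simpa using (hnN.trans_le hM).trans Nat.lt_two_pow_self
  exact ⟨(Fintype.equivFin (Qubits M)).symm ⟨n, hcard⟩, by simpa [decodeProgram] using hn⟩

theorem theorem3_general (k : ℕ) :
    ∃ X : ∀ (M c : ℕ) (P : Type) [Fintype P] [DecidableEq P],
        Fin k → ProverUnitary c (P × Qubits M),
      (∀ (M c : ℕ) (P : Type) [Fintype P] [DecidableEq P] (j : Fin k),
        IsProgrammable (X M c P j)) ∧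
      ∀ (vX vY : ℕ) (P Q : Type) [Fintype P] [DecidableEq P] [Fintype Q] [DecidableEq Q] (ε : ℝ),
        0 < ε → ∃ M₀ : ℕ, ∀ M : ℕ, M₀ ≤ M →
          ∀ (G : QuantumGame k vX vY) (ψ : P × Q → ℂ), IsState ψ →
            ∀ (X' : Fin k → ProverUnitary vX P) (Y' : Fin k → ProverUnitary vY Q),
              ∃ a b : Qubits M,
                G.value (withAncillas ψ (ket a) (ket b)) (X M vX P) (X M vY Q)
                  ≥ G.value ψ X' Y' - ε := by
  refine ⟨fun M c P _ _ j => programUnitary fun a => decodeProgram k c P a j,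
    fun M c P _ _ j => isProgrammable_programUnitary _, fun vX vY P Q _ _ _ _ ε hε => ?_⟩
  have hδ : 0 < ε / (4 * k + 1) := by positivity
  obtain ⟨N, hN⟩ := exists_forall_exists_dist_decodeProgram_lt k vX P hδ
  obtain ⟨N', hN'⟩ := exists_forall_exists_dist_decodeProgram_lt k vY Q hδ
  refine ⟨max N N', fun M hM G ψ hψ X' Y' => ?_⟩
  obtain ⟨a, ha⟩ := hN M (le_of_max_le_left hM) X'
  obtain ⟨b, hb⟩ := hN' M (le_of_max_le_right hM) Y'
  refine ⟨a, b, ?_⟩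
  have hclose := (abs_le.mp (G.abs_value_sub_le_of_dist_le hψ ha.le hb.le)).2
  have hε' : 4 * k * (ε / (4 * k + 1)) ≤ ε := by
    rw [mul_div_assoc', div_le_iff₀ (by positivity)]
    linarith
  rw [G.value_withAncillas]
  linarith

end UniversalCircuit

theorem theorem3 (k : ℕ) (ε : ℝ) (hε : 0 < ε) :
    ∃ X Y : ∀ M c m : ℕ, Fin k → ProverUnitary c (Qubits m × Qubits M),
      (∀ (M c m : ℕ) (j : Fin k), IsProgrammable (X M c m j) ∧ IsProgrammable (Y M c m j)) ∧
      ∀ vX vY m : ℕ, ∃ M₀ : ℕ, ∀ M : ℕ, M₀ ≤ M →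
        ∀ (G : QuantumGame k vX vY) (ψ : Qubits m × Qubits m → ℂ), IsState ψ →
          ∀ (X' : Fin k → ProverUnitary vX (Qubits m)) (Y' : Fin k → ProverUnitary vY (Qubits m)),
            ∃ a b : Qubits M,
              G.value (withAncillas ψ (ket a) (ket b)) (X M vX m) (Y M vY m)
                ≥ G.value ψ X' Y' - ε := by
  obtain ⟨X, hX, hval⟩ := theorem3_general k
  exact ⟨fun M c m => X M c (Qubits m), fun M c m => X M c (Qubits m),
    fun M c m j => ⟨hX _ _ _ j, hX _ _ _ j⟩, fun vX vY m => hval vX vY (Qubits m) (Qubits m) ε hε⟩
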